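/- Let $a>1/2$ and $\alpha=1/a\in(0,2)$. Let $G_1<G_2<\dots$ be the arrival times of a Poisson process of intensity $1$ on $[0,\infty)$ (so that $G_1,G_2-G_1,G_3-G_2,\dots$ are i.i.d. exponential with mean $1$), and put $G_0=1$. Let $\varepsilon_1,\varepsilon_2,\dots$ be i.i.d. real random variables, independent of $(G_n)_{n\ge1}$, with a symmetric distribution ($\varepsilon_1$ and $-\varepsilon_1$ have the same law) and $\mathbb E|\varepsilon_1|^\alpha<\infty$. Define $$X_0=1,\qquad X_n=\Bigl(\frac{G_n}{G_{n-1}}\Bigr)^a X_{n-1}+\varepsilon_n,\quad n=1,2,\dots$$ Then $X_n/n^a$ converges in distribution as $n\to\infty$, and the limit law is the stable law with index of stability $\alpha$, location parameter $1$, skewness $\beta=0$ and scale parameter $$\sigma=\Bigl(\frac{\mathbb E|\varepsilon_1|^\alpha}{c_\alpha}\Bigr)^{a},\qquad c_\alpha=\frac{1-\alpha}{\Gamma(2-\alpha)\cos(\pi\alpha/2)}\ \text{ for }\alpha\neq1,\qquad c_1=\frac2\pi,$$ that is, the probability law on $\mathbb R$ with characteristic function $t\mapsto\exp\bigl(it-\sigma^\alpha|t|^\alpha\bigr)$.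 (If $\varepsilon_1=0$ almost surely, then $\sigma=0$ and the limit is the point mass at $1$.) -/

import Mathlib

open MeasureTheory ProbabilityTheory Filter

noncomputable section

/-- The gaps `G₁, G₂ - G₁, G₃ - G₂, …` of a sequence of times `G₁, G₂, …`; the entry `G 0`
is not used. -/
def interarrival {Ω : Type*} (G : ℕ → Ω → ℝ) : ℕ → Ω → ℝ
  | 0 => G 1
  | n + 1 => fun ω => G (n + 2) ω - G (n + 1) ω

/-- `G₁, G₂, …` are the arrival times of a Poisson process of intensity `r` on `[0, ∞)`: the
waiting times `G₁, G₂ - G₁, …` are independent and exponentially distributed with rate `r`. -/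
structure IsPoissonArrivalTimes {Ω : Type*} [MeasurableSpace Ω] (r : ℝ) (G : ℕ → Ω → ℝ)
    (P : Measure Ω) : Prop where
  indep : iIndepFun (interarrival G) P
  law : ∀ n, HasLaw (interarrival G n) (expMeasure r) P

/-- The logarithm of the characteristic function of the stable law `S_α(σ, β, m)`. -/
def stableExponent (α σ β m t : ℝ) : ℂ :=
  if α = 1 then
    -((σ * |t| : ℝ) : ℂ) * (1 + Complex.I * ((β * (2 / Real.pi) * t.sign * Real.log |t| : ℝ) : ℂ))
      + Complex.I * ((m * t : ℝ) : ℂ)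
  else
    -((σ ^ α * |t| ^ α : ℝ) : ℂ) *
        (1 - Complex.I * ((β * t.sign * Real.tan (Real.pi * α / 2) : ℝ) : ℂ))
      + Complex.I * ((m * t : ℝ) : ℂ)

/-- `ν` is the stable law `S_α(σ, β, m)` with index of stability `α`, scale `σ`, skewness `β`
and location `m`. -/
structure IsStableLaw (α σ β m : ℝ) (ν : Measure ℝ) : Prop where
  index_pos : 0 < α
  index_le : α ≤ 2
  scale_nonneg : 0 ≤ σ
  skewness : |β| ≤ 1
  isProb : IsProbabilityMeasure ν
  charFun_eq : ∀ t : ℝ, charFun ν t = Complex.exp (stableExponent α σ β m t)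

/-- The constant `c_α`. -/
def stableConst (α : ℝ) : ℝ :=
  if α = 1 then 2 / Real.pi
  else (1 - α) / (Real.Gamma (2 - α) * Real.cos (Real.pi * α / 2))

end

open Set Topology

/-! Dividing the recursion by $G_n^a$ makes it telescope: almost surely $X_n =
G_n^a\bigl(1+\sum_{k\le n}\varepsilon_k G_k^{-a}\bigr)$. Since $(G_n/n)^a\to1$ by the strong law,
Slutsky's lemma reduces the claim to convergence in law of the partial sums of this LePage series,
for which characteristic functions suffice.

Given the arrivals, the characteristic function of a partial sum is $\prod_k\varphi(tG_k^{-a})$,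
with $\varphi$ the characteristic function of $\varepsilon_1$, real by symmetry
(`charFun_map_sum_mul_of_symm`). With $h(x)=\varphi(tx^{-a})$, the expectation tends to
$\exp(-\int_0^\infty(1-h))$ (`tendsto_integral_prod_arrivals`). The reason is a martingale:
$u(x)=\exp(-\int_x^\infty(1-h))$ solves $u'=(1-h)u$, so $E\,[h(x+\xi)u(x+\xi)]=u(x)$ for a standard
exponential $\xi$. Hence $E\,[u(G_n)\prod_{k\le n}h(G_k)]=u(0)$ for every $n$, while $u(G_n)\to1$.

Finally $\int_0^\infty(1-h)=|t|^\alpha E|\varepsilon_1|^\alpha/c_\alpha$ by Fubini and the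
substitution $x=y^{-\alpha}$ (`integral_one_sub_integral_cos`), the constant being
$\int_0^\infty\alpha y^{-\alpha-1}(1-\cos y)\,dy=1/c_\alpha$. The limit is continuous at 0, so
Lévy's theorem applies. -/

/-! ### The integrals behind the constant $c_\alpha$ -/

/-- The Laplace transform of `1 - cos`. -/
lemma integral_one_sub_cos_mul_exp_neg {s : ℝ} (hs : 0 < s) :
    IntegrableOn (fun y : ℝ => (1 - Real.cos y) * Real.exp (-(s * y))) (Ioi 0) ∧
      ∫ y in Ioi (0 : ℝ), (1 - Real.cos y) * Real.exp (-(s * y)) = 1 / (s * (1 + s ^ 2)) := by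
  set F : ℝ → ℝ := fun y =>
    -(Real.exp (-(s * y)) / s) + Real.exp (-(s * y)) * (s * Real.cos y - Real.sin y) / (1 + s ^ 2)
  have hE : Tendsto (fun y : ℝ => Real.exp (-(s * y))) atTop (𝓝 0) :=
    Real.tendsto_exp_neg_atTop_nhds_zero.comp (tendsto_id.const_mul_atTop hs)
  have hder : ∀ y ∈ Ioi (0 : ℝ),
      HasDerivAt F ((1 - Real.cos y) * Real.exp (-(s * y))) y := by
    intro y _
    have h1 : HasDerivAt (fun y : ℝ => Real.exp (-(s * y))) (Real.exp (-(s * y)) * (-(s * 1))) y :=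
      (((hasDerivAt_id y).const_mul s).neg).exp
    have h2 := (((Real.hasDerivAt_cos y).const_mul s).sub (Real.hasDerivAt_sin y))
    have h3 := (h1.div_const s).neg.add ((h1.mul h2).div_const (1 + s ^ 2))
    refine h3.congr_deriv ?_
    have : (1 + s ^ 2) ≠ 0 := by positivity
    simp only [Pi.sub_apply]
    field_simp
    ring
  have hlim : Tendsto F atTop (𝓝 0) := by
    have hb : Tendsto (fun y : ℝ => Real.exp (-(s * y)) * (s * Real.cos y - Real.sin y))
        atTop (𝓝 0) := by
      refine squeeze_zero_norm (a := fun y => Real.exp (-(s * y)) * (s + 1)) (fun y => ?_) ?_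
      · rw [norm_mul, Real.norm_eq_abs, Real.abs_exp]
        gcongr
        calc ‖s * Real.cos y - Real.sin y‖ ≤ ‖s * Real.cos y‖ + ‖Real.sin y‖ := norm_sub_le _ _
          _ ≤ s * 1 + 1 := by
            rw [norm_mul, Real.norm_eq_abs s, abs_of_pos hs]
            gcongr
            · exact Real.abs_cos_le_one y
            · exact Real.abs_sin_le_one y
          _ = s + 1 := by ring
      · simpa using hE.mul_const (s + 1)
    simpa [F] using (hE.div_const s).neg.add (hb.div_const (1 + s ^ 2))
  have hcont : ContinuousWithinAt F (Ici 0) 0 := by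
    apply Continuous.continuousWithinAt
    fun_prop
  have hnn : ∀ y ∈ Ioi (0 : ℝ), 0 ≤ (1 - Real.cos y) * Real.exp (-(s * y)) := fun y _ =>
    mul_nonneg (sub_nonneg.2 (Real.cos_le_one y)) (Real.exp_pos _).le
  -- A nonnegative derivative whose primitive has a limit at infinity is integrable.
  refine ⟨integrableOn_Ioi_deriv_of_nonneg hcont hder hnn hlim, ?_⟩
  rw [integral_Ioi_of_hasDerivAt_of_nonneg hcont hder hnn hlim]
  simp only [F, mul_zero, neg_zero, Real.exp_zero, Real.cos_zero, Real.sin_zero]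
  have : (1 + s ^ 2) ≠ 0 := by positivity
  field_simp
  ring

lemma lintegral_rpow_mul_exp_neg_mul_rpow {p q b : ℝ} (hp : 0 < p) (hq : -1 < q) (hb : 0 < b) :
    ∫⁻ x in Ioi (0 : ℝ), ENNReal.ofReal (x ^ q * Real.exp (-b * x ^ p)) =
      ENNReal.ofReal (b ^ (-(q + 1) / p) * (1 / p) * Real.Gamma ((q + 1) / p)) := by
  rw [← integral_rpow_mul_exp_neg_mul_rpow hp hq hb, ofReal_integral_eq_lintegral_ofReal]
  · exact integrableOn_rpow_mul_exp_neg_mul_rpow hq hp hb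
  · filter_upwards [ae_restrict_mem measurableSet_Ioi] with x hx
    exact mul_nonneg (Real.rpow_nonneg (le_of_lt hx) _) (Real.exp_pos _).le

/-- The Mellin transform of `1 / (1 + s ^ 2)`. -/
lemma lintegral_rpow_div_one_add_sq {α : ℝ} (h0 : 0 < α) (h2 : α < 2) :
    ∫⁻ s in Ioi (0 : ℝ), ENNReal.ofReal (s ^ (α - 1) / (1 + s ^ 2)) =
      ENNReal.ofReal (Real.pi / (2 * Real.sin (Real.pi * α / 2))) := by
  -- Write $1/(1+s^2)=\int_0^\infty e^{-r(1+s^2)}\,dr$ and apply Tonelli: the $s$-integral gives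
  -- $\Gamma(\alpha/2)$, the $r$-integral $\Gamma(1-\alpha/2)$, and the reflection formula combines
  -- them.
  have inner : ∀ s ∈ Ioi (0 : ℝ), ENNReal.ofReal (s ^ (α - 1) / (1 + s ^ 2)) =
      ∫⁻ r in Ioi (0 : ℝ), ENNReal.ofReal (s ^ (α - 1) * Real.exp (-r * (1 + s ^ 2))) := by
    intro s hs
    have hs0 : (0 : ℝ) < s := hs
    have h := lintegral_rpow_mul_exp_neg_mul_rpow (p := 1) (q := 0) (b := 1 + s ^ 2) one_pos
      (by norm_num) (by positivity)
    have e : ∀ r : ℝ, ENNReal.ofReal (s ^ (α - 1) * Real.exp (-r * (1 + s ^ 2))) =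
        ENNReal.ofReal (s ^ (α - 1)) *
          ENNReal.ofReal (r ^ (0 : ℝ) * Real.exp (-(1 + s ^ 2) * r ^ (1 : ℝ))) := by
      intro r
      rw [← ENNReal.ofReal_mul (by positivity), Real.rpow_zero, Real.rpow_one, one_mul]
      ring_nf
    simp_rw [e]
    rw [lintegral_const_mul _ (by fun_prop), h, ← ENNReal.ofReal_mul (by positivity)]
    congr 1
    simp only [zero_add, div_one, mul_one, Real.Gamma_one, Real.rpow_neg_one]
    rfl
  rw [setLIntegral_congr_fun measurableSet_Ioi inner, lintegral_lintegral_swap (by fun_prop)]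
  have outer : ∀ r ∈ Ioi (0 : ℝ),
      ∫⁻ s in Ioi (0 : ℝ), ENNReal.ofReal (s ^ (α - 1) * Real.exp (-r * (1 + s ^ 2))) =
      ENNReal.ofReal (Real.Gamma (α / 2) / 2) *
        ENNReal.ofReal (r ^ (-(α / 2)) * Real.exp (-1 * r ^ (1 : ℝ))) := by
    intro r hr
    have hr0 : (0 : ℝ) < r := hr
    have h := lintegral_rpow_mul_exp_neg_mul_rpow (p := 2) (q := α - 1) (b := r) two_pos
      (by linarith) hr0
    have e : ∀ s : ℝ, ENNReal.ofReal (s ^ (α - 1) * Real.exp (-r * (1 + s ^ 2))) =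
        ENNReal.ofReal (Real.exp (-r)) *
          ENNReal.ofReal (s ^ (α - 1) * Real.exp (-r * s ^ (2 : ℝ))) := by
      intro s
      rw [← ENNReal.ofReal_mul (by positivity), Real.rpow_two, mul_add, Real.exp_add]
      ring_nf
    simp_rw [e]
    rw [lintegral_const_mul _ (by fun_prop), h, ← ENNReal.ofReal_mul (by positivity),
      ← ENNReal.ofReal_mul (by have := Real.Gamma_pos_of_pos (half_pos h0); positivity)]
    congr 1
    rw [sub_add_cancel, neg_div, Real.rpow_one, neg_one_mul]
    ring
  rw [setLIntegral_congr_fun measurableSet_Ioi outer, lintegral_const_mul _ (by fun_prop),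
    lintegral_rpow_mul_exp_neg_mul_rpow one_pos (by linarith) one_pos,
    ← ENNReal.ofReal_mul (by have := Real.Gamma_pos_of_pos (half_pos h0); positivity)]
  congr 1
  have := Real.Gamma_mul_Gamma_one_sub (α / 2)
  rw [Real.one_rpow, div_one, div_one, one_mul, one_mul, div_mul_eq_mul_div,
    show -(α / 2) + 1 = 1 - α / 2 by ring, this, ← mul_div_assoc]
  ring_nf

/-- Reflection and the double-angle formula cancel the factors $1-\alpha$ and $\cos(\pi\alpha/2)$,
leaving one expression that also covers $\alpha=1$. -/
lemma inv_stableConst {α : ℝ} (h0 : 0 < α) (h2 : α < 2) :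
    (stableConst α)⁻¹ = Real.pi / (2 * Real.Gamma α * Real.sin (Real.pi * α / 2)) := by
  unfold stableConst
  split_ifs with h1
  · subst h1
    simp
  · have e1 : Real.Gamma (2 - α) = (1 - α) * Real.Gamma (1 - α) := by
      rw [← Real.Gamma_add_one (sub_ne_zero.2 (Ne.symm h1))]; ring_nf
    have e2 := Real.Gamma_mul_Gamma_one_sub α
    have e3 : Real.sin (Real.pi * α) =
        2 * Real.sin (Real.pi * α / 2) * Real.cos (Real.pi * α / 2) := by
      rw [← Real.sin_two_mul]; ring_nf
    have hG := Real.Gamma_pos_of_pos h0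
    have hs : 0 < Real.sin (Real.pi * α / 2) := by
      apply Real.sin_pos_of_pos_of_lt_pi <;> nlinarith [Real.pi_pos]
    -- On $(0,\pi)$ the cosine vanishes only at $\pi/2$, which would force $\alpha=1$.
    have hc : Real.cos (Real.pi * α / 2) ≠ 0 := by
      intro hc
      have : Real.sin (Real.pi * α / 2) ^ 2 = 1 := by
        nlinarith [Real.sin_sq_add_cos_sq (Real.pi * α / 2)]
      have h4 : Real.sin (Real.pi * α / 2) = 1 := by nlinarith
      have h5 : Real.pi * α / 2 = Real.pi / 2 := by
        rcases lt_trichotomy (Real.pi * α / 2) (Real.pi / 2) with h | h | h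
        · exact absurd hc (Real.cos_pos_of_mem_Ioo ⟨by nlinarith [Real.pi_pos], h⟩).ne'
        · exact h
        · exact absurd hc (Real.cos_neg_of_pi_div_two_lt_of_lt h (by nlinarith [Real.pi_pos])).ne
      apply h1
      have := Real.pi_pos
      field_simp at h5
      linarith
    have h1' : 1 - α ≠ 0 := sub_ne_zero.2 (Ne.symm h1)
    rw [e3, eq_div_iff (mul_ne_zero (mul_ne_zero two_ne_zero hs.ne') hc)] at e2
    rw [e1, inv_div, div_eq_div_iff h1' (mul_ne_zero (mul_ne_zero two_ne_zero hG.ne') hs.ne')]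
    linear_combination (1 - α) * e2

lemma stableConst_pos {α : ℝ} (h0 : 0 < α) (h2 : α < 2) : 0 < stableConst α := by
  rw [← inv_pos, inv_stableConst h0 h2]
  have hG := Real.Gamma_pos_of_pos h0
  have hs : 0 < Real.sin (Real.pi * α / 2) := by
    apply Real.sin_pos_of_pos_of_lt_pi <;> nlinarith [Real.pi_pos]
  have := Real.pi_pos
  positivity

/-- Expand $y^{-\alpha-1}=\Gamma(\alpha+1)^{-1}\int_0^\infty s^\alpha e^{-sy}\,ds$ and swap: the
Laplace transform of $1-\cos$ leaves the Mellin transform of $1/(1+s^2)$. Lower integrals make the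
swap free, and finiteness is read off the value. -/
lemma lintegral_one_sub_cos_mul_rpow {α : ℝ} (h0 : 0 < α) (h2 : α < 2) :
    ∫⁻ y in Ioi (0 : ℝ), ENNReal.ofReal (α * y ^ (-α - 1) * (1 - Real.cos y)) =
      ENNReal.ofReal (stableConst α)⁻¹ := by
  have hG := Real.Gamma_pos_of_pos h0
  have inner : ∀ y ∈ Ioi (0 : ℝ), ENNReal.ofReal (α * y ^ (-α - 1) * (1 - Real.cos y)) =
      ∫⁻ s in Ioi (0 : ℝ), ENNReal.ofReal
        ((Real.Gamma α)⁻¹ * s ^ α * ((1 - Real.cos y) * Real.exp (-(s * y)))) := by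
    intro y hy
    have hy0 : (0 : ℝ) < y := hy
    have h := lintegral_rpow_mul_exp_neg_mul_rpow (p := 1) (q := α) (b := y) one_pos
      (by linarith) hy0
    have hc : 0 ≤ 1 - Real.cos y := sub_nonneg.2 (Real.cos_le_one y)
    have e : ∀ s : ℝ, ENNReal.ofReal
        ((Real.Gamma α)⁻¹ * s ^ α * ((1 - Real.cos y) * Real.exp (-(s * y)))) =
        ENNReal.ofReal ((Real.Gamma α)⁻¹ * (1 - Real.cos y)) *
          ENNReal.ofReal (s ^ α * Real.exp (-y * s ^ (1 : ℝ))) := by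
      intro s
      rw [← ENNReal.ofReal_mul (by positivity), Real.rpow_one]
      ring_nf
    simp_rw [e]
    rw [lintegral_const_mul _ (by fun_prop), h, ← ENNReal.ofReal_mul (by positivity)]
    congr 1
    rw [div_one, div_one, div_one, Real.Gamma_add_one h0.ne', show -(α + 1) = -α - 1 by ring]
    field_simp
  rw [setLIntegral_congr_fun measurableSet_Ioi inner, lintegral_lintegral_swap (by fun_prop)]
  have outer : ∀ s ∈ Ioi (0 : ℝ), ∫⁻ y in Ioi (0 : ℝ), ENNReal.ofReal
        ((Real.Gamma α)⁻¹ * s ^ α * ((1 - Real.cos y) * Real.exp (-(s * y)))) =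
      ENNReal.ofReal (Real.Gamma α)⁻¹ * ENNReal.ofReal (s ^ (α - 1) / (1 + s ^ 2)) := by
    intro s hs
    have hs0 : (0 : ℝ) < s := hs
    obtain ⟨hi, hv⟩ := integral_one_sub_cos_mul_exp_neg hs0
    simp_rw [ENNReal.ofReal_mul (show 0 ≤ (Real.Gamma α)⁻¹ * s ^ α by positivity)]
    rw [lintegral_const_mul _ (by fun_prop), ← ofReal_integral_eq_lintegral_ofReal hi, hv,
      ← ENNReal.ofReal_mul (by positivity), ← ENNReal.ofReal_mul (by positivity)]
    · congr 1
      rw [Real.rpow_sub_one hs0.ne']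
      field_simp
    · exact ae_of_all _ fun y =>
        mul_nonneg (sub_nonneg.2 (Real.cos_le_one y)) (Real.exp_pos _).le
  rw [setLIntegral_congr_fun measurableSet_Ioi outer, lintegral_const_mul _ (by fun_prop),
    lintegral_rpow_div_one_add_sq h0 h2, ← ENNReal.ofReal_mul (by positivity),
    inv_stableConst h0 h2]
  congr 1
  field_simp

/-- Since $a\alpha=1$, the substitution $x=y^{-\alpha}$ turns $x^{-a}$ into $y$ and $dx$ into
$\alpha y^{-\alpha-1}dy$; rescaling $y$ by $|c|$ then extracts $|c|^\alpha$. -/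
lemma integral_one_sub_cos_mul_rpow_neg {a α : ℝ} (ha : 1 / 2 < a) (hα : α = 1 / a) (c : ℝ) :
    IntegrableOn (fun x : ℝ => 1 - Real.cos (c * x ^ (-a))) (Ioi 0) ∧
      ∫ x in Ioi (0 : ℝ), (1 - Real.cos (c * x ^ (-a))) = |c| ^ α / stableConst α := by
  have ha0 : 0 < a := by linarith
  have h0 : 0 < α := by rw [hα]; positivity
  have h2 : α < 2 := by rw [hα, div_lt_iff₀ ha0]; linarith
  set f : ℝ → ℝ := fun y => α * y ^ (-α - 1) * (1 - Real.cos y)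
  have hf0 : 0 ≤ᵐ[volume.restrict (Ioi (0 : ℝ))] f := by
    filter_upwards [ae_restrict_mem measurableSet_Ioi] with y hy
    exact mul_nonneg (mul_nonneg h0.le (Real.rpow_nonneg (le_of_lt hy) _))
      (sub_nonneg.2 (Real.cos_le_one y))
  have hfm : AEStronglyMeasurable f (volume.restrict (Ioi (0 : ℝ))) := by
    apply Measurable.aestronglyMeasurable
    fun_prop
  have hfl := lintegral_one_sub_cos_mul_rpow h0 h2
  have hfi : IntegrableOn f (Ioi 0) := by
    refine ⟨hfm, ?_⟩
    rw [hasFiniteIntegral_iff_ofReal hf0, hfl]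
    exact ENNReal.ofReal_lt_top
  have hfv : ∫ y in Ioi (0 : ℝ), f y = (stableConst α)⁻¹ := by
    rw [integral_eq_lintegral_of_nonneg_ae hf0 hfm, hfl,
      ENNReal.toReal_ofReal (inv_nonneg.2 (stableConst_pos h0 h2).le)]
  rcases eq_or_ne c 0 with rfl | hc
  · simp [Real.zero_rpow h0.ne']
  have hc0 : 0 < |c| := abs_pos.2 hc
  have key : ∀ y ∈ Ioi (0 : ℝ), |-α| * y ^ (-α - 1) * (1 - Real.cos (c * (y ^ (-α)) ^ (-a))) =
      |c| ^ α * |c| * f (|c| * y) := by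
    intro y hy
    have hy0 : (0 : ℝ) < y := hy
    have e1 : (y ^ (-α)) ^ (-a) = y := by
      rw [← Real.rpow_mul hy0.le, hα]
      field_simp
      simp
    have e2 : Real.cos (c * y) = Real.cos (|c| * y) := by
      rw [← Real.cos_abs, abs_mul, abs_of_pos hy0]
    have e3 : |c| ^ (-α - 1) * (|c| ^ α * |c|) = 1 := by
      rw [← Real.rpow_add_one hc0.ne', ← Real.rpow_add hc0]
      simp
    simp only [f]
    rw [e1, e2, abs_neg, abs_of_pos h0, Real.mul_rpow hc0.le hy0.le]
    linear_combination (-(α * y ^ (-α - 1) * (1 - Real.cos (|c| * y)))) * e3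
  constructor
  · rw [← integrableOn_Ioi_comp_rpow_iff (fun x : ℝ => 1 - Real.cos (c * x ^ (-a)))
      (neg_ne_zero.2 h0.ne')]
    simp only [smul_eq_mul]
    rw [integrableOn_congr_fun key measurableSet_Ioi]
    refine Integrable.const_mul ?_ _
    have := (integrableOn_Ioi_comp_mul_left_iff f 0 hc0).2 (by simpa using hfi)
    exact this
  · rw [← integral_comp_rpow_Ioi (fun x : ℝ => 1 - Real.cos (c * x ^ (-a)))
      (neg_ne_zero.2 h0.ne')]
    simp only [smul_eq_mul]
    rw [setIntegral_congr_fun measurableSet_Ioi key, integral_const_mul,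
      integral_comp_mul_left_Ioi f 0 hc0, mul_zero, hfv, smul_eq_mul]
    field_simp

/-! ### The standard exponential law -/

lemma measurable_exponentialPDF (r : ℝ) : Measurable (exponentialPDF r) :=
  (measurable_exponentialPDFReal r).ennreal_ofReal

lemma integral_expMeasure_one (f : ℝ → ℝ) :
    ∫ y, f y ∂(expMeasure 1) = ∫ y in Ioi (0 : ℝ), Real.exp (-y) * f y := by
  have h1 : expMeasure 1 = volume.withDensity (exponentialPDF 1) := rfl
  rw [h1, integral_withDensity_eq_integral_toReal_smul
    (measurable_exponentialPDF 1)
    (ae_of_all _ fun x => ENNReal.ofReal_lt_top), ← integral_Ici_eq_integral_Ioi,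
    ← integral_indicator measurableSet_Ici]
  congr 1
  ext y
  rw [exponentialPDF_eq]
  by_cases hy : 0 ≤ y
  · rw [if_pos hy, indicator_of_mem (by exact hy), one_mul, one_mul,
      ENNReal.toReal_ofReal (Real.exp_pos _).le, smul_eq_mul]
  · rw [if_neg hy, indicator_of_notMem (by exact hy)]
    simp

lemma expMeasure_one_Iic_zero : expMeasure 1 (Iic 0) = 0 := by
  have h1 : expMeasure 1 = volume.withDensity (exponentialPDF 1) := rfl
  rw [h1, withDensity_apply _ measurableSet_Iic, ← setLIntegral_congr Iio_ae_eq_Iic]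
  exact lintegral_exponentialPDF_of_nonpos le_rfl

lemma integrable_id_expMeasure_one : Integrable (fun x : ℝ => x) (expMeasure 1) := by
  have h1 : expMeasure 1 = volume.withDensity (exponentialPDF 1) := rfl
  rw [h1, integrable_withDensity_iff_integrable_smul'
    (measurable_exponentialPDF 1)
    (ae_of_all _ fun x => ENNReal.ofReal_lt_top)]
  have h2 : IntegrableOn (fun x : ℝ => Real.exp (-x) * x ^ ((2 : ℝ) - 1)) (Ioi 0) :=
    Real.GammaIntegral_convergent two_pos
  rw [← integrableOn_Ici_iff_integrableOn_Ioi, ← integrable_indicator_iff measurableSet_Ici] at h2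
  refine h2.congr (ae_of_all _ fun y => ?_)
  dsimp only
  rw [exponentialPDF_eq]
  by_cases hy : 0 ≤ y
  · rw [if_pos hy, indicator_of_mem (by exact hy), one_mul, one_mul,
      ENNReal.toReal_ofReal (Real.exp_pos _).le, smul_eq_mul]
    norm_num
  · rw [if_neg hy, indicator_of_notMem (by exact hy)]
    simp

lemma integral_id_expMeasure_one : ∫ x, x ∂(expMeasure 1) = 1 := by
  rw [integral_expMeasure_one]
  have h := Real.Gamma_eq_integral (s := 2) two_pos
  norm_num at h
  exact h.symm

/-! ### The harmonic weight $u$ -/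

/-- The exponential of minus the integral of `1 - h` over `(x, ∞)`. -/
noncomputable def tailWeight (h : ℝ → ℝ) (x : ℝ) : ℝ :=
  Real.exp (-((∫ z in Ioi 0, (1 - h z)) - ∫ z in (0 : ℝ)..x, (1 - h z)))

section tailWeight

variable {h : ℝ → ℝ}

lemma tailWeight_zero : tailWeight h 0 = Real.exp (-(∫ z in Ioi 0, (1 - h z))) := by
  simp [tailWeight]

lemma tailWeight_pos (x : ℝ) : 0 < tailWeight h x := Real.exp_pos _

lemma continuous_tailWeight (hi : Integrable (fun x => 1 - h x)) : Continuous (tailWeight h) := by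
  unfold tailWeight
  have := intervalIntegral.continuous_primitive (μ := volume)
    (fun a b => hi.intervalIntegrable (a := a) (b := b)) 0
  fun_prop

lemma tendsto_tailWeight (hi : Integrable (fun x => 1 - h x)) :
    Tendsto (tailWeight h) atTop (𝓝 1) := by
  have h1 := intervalIntegral_tendsto_integral_Ioi 0 hi.integrableOn tendsto_id
  have h2 := (h1.const_sub (∫ z in Ioi 0, (1 - h z))).neg.rexp
  simp only [id, sub_self, neg_zero, Real.exp_zero] at h2
  exact h2

lemma monotone_tailWeight (hi : Integrable (fun x => 1 - h x)) (h1 : ∀ x, |h x| ≤ 1) :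
    Monotone (tailWeight h) := by
  intro x y hxy
  unfold tailWeight
  have e := intervalIntegral.integral_interval_sub_left
    (hi.intervalIntegrable (a := 0) (b := y)) (hi.intervalIntegrable (a := 0) (b := x))
  have p : 0 ≤ ∫ z in x..y, (1 - h z) :=
    intervalIntegral.integral_nonneg hxy fun z _ => sub_nonneg.2 (abs_le.1 (h1 z)).2
  gcongr
  linarith

lemma tailWeight_le_one (hi : Integrable (fun x => 1 - h x)) (h1 : ∀ x, |h x| ≤ 1) (x : ℝ) :
    tailWeight h x ≤ 1 :=
  (monotone_tailWeight hi h1).ge_of_tendsto (tendsto_tailWeight hi) x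

/-- The tail integral is defined as a constant minus a primitive, so the fundamental theorem of
calculus applies. -/
lemma hasDerivAt_tailWeight (hm : Measurable h) (hi : Integrable (fun x => 1 - h x))
    {x : ℝ} (hc : ContinuousAt h x) :
    HasDerivAt (tailWeight h) ((1 - h x) * tailWeight h x) x := by
  have h1 : HasDerivAt (fun x => ∫ z in (0 : ℝ)..x, (1 - h z)) (1 - h x) x :=
    intervalIntegral.integral_hasDerivAt_right hi.intervalIntegrable
      (Measurable.stronglyMeasurable (by fun_prop)).stronglyMeasurableAtFilter (by fun_prop)
  refine ((h1.const_sub (∫ z in Ioi 0, (1 - h z))).neg.exp).congr_deriv ?_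
  rw [neg_neg, mul_comm]
  rfl

/-- The weight is harmonic for an exponential jump killed at rate `1 - h`. -/
lemma integral_expMeasure_mul_tailWeight (hm : Measurable h) (hi : Integrable (fun x => 1 - h x))
    (h1 : ∀ x, |h x| ≤ 1) (hc : ContinuousOn h (Ioi 0)) {x : ℝ} (hx : 0 ≤ x) :
    ∫ y, h (x + y) * tailWeight h (x + y) ∂(expMeasure 1) = tailWeight h x := by
  rw [integral_expMeasure_one]
  have hu := continuous_tailWeight hi
  -- By $u'=(1-h)u$ and the product rule, $-e^{-y}u(x+y)$ is an antiderivative; it is $-u(x)$ at 0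
  -- and vanishes at infinity. Only $x+y>0$ occurs, so continuity of $h$ on the open half-line is
  -- enough.
  have hder : ∀ y ∈ Ioi (0 : ℝ), HasDerivAt (fun y => -(Real.exp (-y) * tailWeight h (x + y)))
      (Real.exp (-y) * (h (x + y) * tailWeight h (x + y))) y := by
    intro y hy
    have hy0 : (0 : ℝ) < y := hy
    have hca : ContinuousAt h (x + y) := hc.continuousAt (Ioi_mem_nhds (by positivity))
    have d1 : HasDerivAt (fun y : ℝ => Real.exp (-y)) (Real.exp (-y) * (-1)) y :=
      (hasDerivAt_id y).neg.exp
    have d2 := (hasDerivAt_tailWeight hm hi hca).comp_const_add x y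
    refine (d1.mul d2).neg.congr_deriv ?_
    ring
  have hint : IntegrableOn (fun y => Real.exp (-y) * (h (x + y) * tailWeight h (x + y)))
      (Ioi 0) := by
    have h0 : IntegrableOn (fun y : ℝ => Real.exp (-y)) (Ioi 0) := integrableOn_exp_neg_Ioi 0
    refine h0.mono' (Measurable.aestronglyMeasurable (by have := hu.measurable; fun_prop))
      (ae_of_all _ fun y => ?_)
    rw [norm_mul, norm_mul, Real.norm_eq_abs, Real.abs_exp, Real.norm_eq_abs, Real.norm_eq_abs,
      abs_of_pos (tailWeight_pos _)]
    exact mul_le_of_le_one_right (Real.exp_pos _).le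
      (mul_le_one₀ (h1 _) (tailWeight_pos _).le (tailWeight_le_one hi h1 _))
  have hlim : Tendsto (fun y => -(Real.exp (-y) * tailWeight h (x + y))) atTop (𝓝 0) := by
    have := (Real.tendsto_exp_neg_atTop_nhds_zero.mul
      ((tendsto_tailWeight hi).comp (tendsto_atTop_add_const_left atTop x tendsto_id))).neg
    simpa using this
  rw [integral_Ioi_of_hasDerivAt_of_tendsto (Continuous.continuousWithinAt (by fun_prop))
    hder hint hlim]
  simp

end tailWeight

/-! ### The generating functional of the Poisson process -/

/-- Integrating out one of two independent random variables. -/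
lemma ProbabilityTheory.IndepFun.integral_comp_prodMk {Ω E F V : Type*} [MeasurableSpace Ω]
    [MeasurableSpace E] [MeasurableSpace F] [NormedAddCommGroup V] [NormedSpace ℝ V]
    {P : Measure Ω} [IsProbabilityMeasure P]
    {X : Ω → E} {Y : Ω → F} (hXY : IndepFun X Y P) (hX : AEMeasurable X P) (hY : AEMeasurable Y P)
    {f : E × F → V} (hf : StronglyMeasurable f) {C : ℝ} (hC : ∀ p, ‖f p‖ ≤ C) :
    ∫ ω, f (X ω, Y ω) ∂P = ∫ ω, ∫ y, f (X ω, y) ∂(P.map Y) ∂P := by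
  have := Measure.isProbabilityMeasure_map hX
  have := Measure.isProbabilityMeasure_map hY
  have h1 : ∫ ω, f (X ω, Y ω) ∂P = ∫ p, f p ∂(P.map fun ω => (X ω, Y ω)) :=
    (integral_map (hX.prodMk hY) hf.aestronglyMeasurable).symm
  rw [h1, (indepFun_iff_map_prod_eq_prod_map_map hX hY).1 hXY,
    integral_prod _ (Integrable.of_bound hf.aestronglyMeasurable C (ae_of_all _ hC)),
    integral_map hX hf.integral_prod_right'.aestronglyMeasurable]

section Poisson

variable {Ω : Type*} [MeasurableSpace Ω] {P : Measure Ω} {ξ : ℕ → Ω → ℝ}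

lemma ae_forall_pos_of_hasLaw_exp (hlaw : ∀ n, HasLaw (ξ n) (expMeasure 1) P) :
    ∀ᵐ ω ∂P, ∀ n, 0 < ξ n ω := by
  rw [ae_all_iff]
  intro n
  have h1 : ∀ᵐ x ∂(P.map (ξ n)), 0 < x := by
    rw [(hlaw n).map_eq, ae_iff]
    simp only [not_lt]
    exact expMeasure_one_Iic_zero
  exact ae_of_ae_map (hlaw n).aemeasurable h1

/-- The strong law, used both to send the arrivals to infinity and to compare $G_n^a$ with $n^a$. -/
lemma tendsto_sum_div_of_hasLaw_exp (hind : iIndepFun ξ P)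
    (hlaw : ∀ n, HasLaw (ξ n) (expMeasure 1) P) :
    ∀ᵐ ω ∂P, Tendsto (fun n : ℕ => (∑ j ∈ Finset.range n, ξ j ω) / n) atTop (𝓝 1) := by
  have hint : Integrable (ξ 0) P := by
    have h1 := integrable_id_expMeasure_one
    rw [← (hlaw 0).map_eq] at h1
    exact h1.comp_aemeasurable (hlaw 0).aemeasurable
  have hmean : ∫ ω, ξ 0 ω ∂P = 1 := by
    rw [← integral_id_expMeasure_one, ← (hlaw 0).map_eq,
      integral_map (hlaw 0).aemeasurable measurable_id'.aestronglyMeasurable]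
  rw [← hmean]
  exact strong_law_ae_real ξ hint (fun i j hij => hind.indepFun hij) fun i =>
    ⟨(hlaw i).aemeasurable, (hlaw 0).aemeasurable, (hlaw i).map_eq.trans (hlaw 0).map_eq.symm⟩

variable [IsProbabilityMeasure P]

/-- The product of `h` over the arrivals, weighted by the tail weight at the last arrival, has
constant expectation. -/
lemma integral_prod_mul_tailWeight (hind : iIndepFun ξ P)
    (hlaw : ∀ n, HasLaw (ξ n) (expMeasure 1) P) {h : ℝ → ℝ} (hm : Measurable h)
    (hi : Integrable (fun x => 1 - h x)) (h1 : ∀ x, |h x| ≤ 1) (hc : ContinuousOn h (Ioi 0))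
    (n : ℕ) :
    ∫ ω, (∏ k ∈ Finset.range n, h (∑ j ∈ Finset.range (k + 1), ξ j ω)) *
      tailWeight h (∑ j ∈ Finset.range n, ξ j ω) ∂P = tailWeight h 0 := by
  have hu := (continuous_tailWeight hi).measurable
  induction n with
  | zero => simp
  | succ n ih =>
    -- `W` exhibits the product and the last arrival as a measurable function of the first $n$ gaps
    -- alone, hence independent of the next gap. The default 0 is never reached, as all indices are
    -- below $n$.
    set W : (Finset.range n → ℝ) → ℝ × ℝ := fun v =>
      (∏ k ∈ Finset.range n,
        h (∑ j ∈ Finset.range (k + 1), if hj : j ∈ Finset.range n then v ⟨j, hj⟩ else 0),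
      ∑ j ∈ Finset.range n, if hj : j ∈ Finset.range n then v ⟨j, hj⟩ else 0) with hW
    have hWm : Measurable W := by
      have : ∀ j, Measurable fun v : Finset.range n → ℝ =>
          if hj : j ∈ Finset.range n then v ⟨j, hj⟩ else 0 := by
        intro j
        split_ifs
        · fun_prop
        · fun_prop
      fun_prop
    have hWe : ∀ ω, W (fun i => ξ i ω) =
        (∏ k ∈ Finset.range n, h (∑ j ∈ Finset.range (k + 1), ξ j ω),
          ∑ j ∈ Finset.range n, ξ j ω) := by
      intro ω
      simp only [hW, Prod.mk.injEq]
      constructor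
      · refine Finset.prod_congr rfl fun k hk => ?_
        congr 1
        refine Finset.sum_congr rfl fun j hj => ?_
        rw [dif_pos]
        simp only [Finset.mem_range] at *
        omega
      · exact Finset.sum_congr rfl fun j hj => by rw [dif_pos hj]
    have hindn : IndepFun (fun ω => (∏ k ∈ Finset.range n, h (∑ j ∈ Finset.range (k + 1), ξ j ω),
          ∑ j ∈ Finset.range n, ξ j ω)) (ξ n) P := by
      have := (hind.indepFun_finset₀ (Finset.range n) {n} (by simp)
        (fun i => (hlaw i).aemeasurable)).comp hWm
        (measurable_pi_apply (⟨n, Finset.mem_singleton_self n⟩ : ({n} : Finset ℕ)))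
      simpa only [Function.comp_def, hWe] using this
    have hX : AEMeasurable (fun ω => (∏ k ∈ Finset.range n, h (∑ j ∈ Finset.range (k + 1), ξ j ω),
          ∑ j ∈ Finset.range n, ξ j ω)) P := by
      have := hWm.comp_aemeasurable (μ := P) (f := fun ω (i : Finset.range n) => ξ i ω)
        (aemeasurable_pi_lambda _ fun i => (hlaw i).aemeasurable)
      simpa only [Function.comp_def, hWe] using this
    -- clamping the first coordinate makes the integrand bounded
    set f : (ℝ × ℝ) × ℝ → ℝ := fun p =>
      max (-1) (min 1 p.1.1) * (h (p.1.2 + p.2) * tailWeight h (p.1.2 + p.2)) with hf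
    have hfm : StronglyMeasurable f := Measurable.stronglyMeasurable (by fun_prop)
    have hu1 : ∀ x, |tailWeight h x| ≤ 1 := fun x => by
      rw [abs_of_pos (tailWeight_pos x)]; exact tailWeight_le_one hi h1 x
    have hfb : ∀ p, ‖f p‖ ≤ 1 := by
      intro p
      rw [hf, norm_mul, norm_mul]
      refine mul_le_one₀ ?_ (by positivity) (mul_le_one₀ (h1 _) (by positivity) (hu1 _))
      rw [Real.norm_eq_abs, abs_le]
      exact ⟨le_max_left _ _, max_le (by norm_num) (min_le_left _ _)⟩
    have hWb : ∀ ω, max (-1) (min 1 (∏ k ∈ Finset.range n,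
        h (∑ j ∈ Finset.range (k + 1), ξ j ω))) =
        ∏ k ∈ Finset.range n, h (∑ j ∈ Finset.range (k + 1), ξ j ω) := by
      intro ω
      have : |∏ k ∈ Finset.range n, h (∑ j ∈ Finset.range (k + 1), ξ j ω)| ≤ 1 := by
        rw [Finset.abs_prod]
        exact Finset.prod_le_one (fun _ _ => abs_nonneg _) fun _ _ => h1 _
      rw [abs_le] at this
      rw [min_eq_right this.2, max_eq_right this.1]
    have key := hindn.integral_comp_prodMk hX (hlaw n).aemeasurable hfm hfb
    simp only [hf, hWb, (hlaw n).map_eq] at key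
    rw [← ih]
    calc _ = _ := by
          refine Eq.trans ?_ key
          refine integral_congr_ae (ae_of_all _ fun ω => ?_)
          dsimp only
          rw [Finset.prod_range_succ, Finset.sum_range_succ, mul_assoc]
      _ = _ := by
          refine integral_congr_ae ?_
          -- Harmonicity of the weight is available only at nonnegative points, which the partial
          -- sums almost surely are.
          filter_upwards [ae_forall_pos_of_hasLaw_exp hlaw] with ω hω
          rw [integral_const_mul, integral_expMeasure_mul_tailWeight hm hi h1 hc
            (Finset.sum_nonneg fun j _ => (hω j).le)]

/-- The generating functional of the Poisson process, as a limit over its first arrivals. -/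
lemma tendsto_integral_prod_arrivals (hind : iIndepFun ξ P)
    (hlaw : ∀ n, HasLaw (ξ n) (expMeasure 1) P) {h : ℝ → ℝ} (hm : Measurable h)
    (hi : Integrable (fun x => 1 - h x)) (h1 : ∀ x, |h x| ≤ 1) (hc : ContinuousOn h (Ioi 0)) :
    Tendsto (fun n => ∫ ω, ∏ k ∈ Finset.range n, h (∑ j ∈ Finset.range (k + 1), ξ j ω) ∂P) atTop
      (𝓝 (Real.exp (-∫ x in Ioi 0, (1 - h x)))) := by
  have hu := (continuous_tailWeight hi).measurable
  have hξ : ∀ n, AEMeasurable (ξ n) P := fun n => (hlaw n).aemeasurable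
  have hu1 : ∀ x, |tailWeight h x| ≤ 1 := fun x => by
    rw [abs_of_pos (tailWeight_pos x)]; exact tailWeight_le_one hi h1 x
  have hp1 : ∀ n ω, |∏ k ∈ Finset.range n, h (∑ j ∈ Finset.range (k + 1), ξ j ω)| ≤ 1 := by
    intro n ω
    rw [Finset.abs_prod]
    exact Finset.prod_le_one (fun _ _ => abs_nonneg _) fun _ _ => h1 _
  have hpm : ∀ n, AEMeasurable
      (fun ω => ∏ k ∈ Finset.range n, h (∑ j ∈ Finset.range (k + 1), ξ j ω)) P := by
    intro n
    refine Finset.aemeasurable_fun_prod _ fun k _ => hm.comp_aemeasurable ?_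
    exact Finset.aemeasurable_fun_sum _ fun j _ => hξ j
  have hsm : ∀ n, AEMeasurable (fun ω => tailWeight h (∑ j ∈ Finset.range n, ξ j ω)) P :=
    fun n => hu.comp_aemeasurable (Finset.aemeasurable_fun_sum _ fun j _ => hξ j)
  have hT : ∀ᵐ ω ∂P, Tendsto (fun n : ℕ => ∑ j ∈ Finset.range n, ξ j ω) atTop atTop := by
    filter_upwards [tendsto_sum_div_of_hasLaw_exp hind hlaw] with ω hω
    have := hω.pos_mul_atTop one_pos tendsto_natCast_atTop_atTop
    refine this.congr' ?_
    filter_upwards [eventually_ne_atTop 0] with n hn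
    have : (n : ℝ) ≠ 0 := by exact_mod_cast hn
    field_simp
  -- Replacing the weight by its limit 1 costs $o(1)$, by dominated convergence.
  have hdiff : Tendsto (fun n => ∫ ω,
      (∏ k ∈ Finset.range n, h (∑ j ∈ Finset.range (k + 1), ξ j ω)) *
        (1 - tailWeight h (∑ j ∈ Finset.range n, ξ j ω)) ∂P) atTop (𝓝 (∫ _, 0 ∂P)) := by
    refine tendsto_integral_of_dominated_convergence (fun _ => 1)
      (fun n => ((hpm n).mul ((hsm n).const_sub 1)).aestronglyMeasurable)
      (integrable_const 1) (fun n => ae_of_all _ fun ω => ?_) ?_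
    · rw [norm_mul]
      refine mul_le_one₀ (hp1 n ω) (norm_nonneg _) ?_
      rw [Real.norm_eq_abs, abs_of_nonneg (sub_nonneg.2 (tailWeight_le_one hi h1 _))]
      linarith [tailWeight_pos (h := h) (∑ j ∈ Finset.range n, ξ j ω)]
    · filter_upwards [hT] with ω hω
      refine squeeze_zero_norm (a := fun n => |1 - tailWeight h (∑ j ∈ Finset.range n, ξ j ω)|)
        (fun n => ?_) ?_
      · rw [norm_mul]
        exact mul_le_of_le_one_left (abs_nonneg _) (hp1 n ω)
      · simpa using (((tendsto_tailWeight hi).comp hω).const_sub 1).abs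
  rw [integral_zero] at hdiff
  rw [← tailWeight_zero, ← zero_add (tailWeight h 0)]
  refine (hdiff.add_const (tailWeight h 0)).congr fun n => ?_
  rw [← integral_prod_mul_tailWeight hind hlaw hm hi h1 hc n, ← integral_add]
  · refine integral_congr_ae (ae_of_all _ fun ω => ?_)
    dsimp only
    ring
  · refine Integrable.of_bound ((hpm n).mul ((hsm n).const_sub 1)).aestronglyMeasurable 1
      (ae_of_all _ fun ω => ?_)
    rw [norm_mul]
    refine mul_le_one₀ (hp1 n ω) (norm_nonneg _) ?_
    rw [Real.norm_eq_abs, abs_of_nonneg (sub_nonneg.2 (tailWeight_le_one hi h1 _))]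
    linarith [tailWeight_pos (h := h) (∑ j ∈ Finset.range n, ξ j ω)]
  · refine Integrable.of_bound ((hpm n).mul (hsm n)).aestronglyMeasurable 1
      (ae_of_all _ fun ω => ?_)
    rw [norm_mul]
    exact mul_le_one₀ (hp1 n ω) (norm_nonneg _) (hu1 _)

end Poisson

/-! ### Characteristic functions and weak convergence -/

/-- A pointwise limit of characteristic functions that is continuous at `0` is the characteristic
function of a probability measure, and the measures converge weakly. -/
lemma exists_tendsto_of_tendsto_charFun {μ : ℕ → ProbabilityMeasure ℝ} {f : ℝ → ℂ}
    (hf : ContinuousAt f 0)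
    (h : ∀ t, Tendsto (fun n => charFun (μ n : Measure ℝ) t) atTop (𝓝 (f t))) :
    ∃ ν : ProbabilityMeasure ℝ, Tendsto μ atTop (𝓝 ν) ∧ ∀ t, charFun (ν : Measure ℝ) t = f t := by
  have htight := isTightMeasureSet_of_tendsto_charFun (μ := fun n => (μ n : Measure ℝ)) hf h
  have hcomp : IsCompact (closure (range μ)) := by
    apply isCompact_closure_of_isTightMeasureSet
    convert htight using 1
    ext m
    simp
  -- By tightness the laws converge along a nonprincipal ultrafilter. It refines `atTop`, so the
  -- limit has characteristic function $f$; this supplies the measure needed for convergence of the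
  -- whole sequence.
  have hU : (Ultrafilter.map μ (hyperfilter ℕ) : Filter (ProbabilityMeasure ℝ)) ≤
      𝓟 (closure (range μ)) := by
    rw [le_principal_iff]
    exact mem_of_superset (range_mem_map) subset_closure
  obtain ⟨ν, -, hν⟩ := hcomp.ultrafilter_le_nhds _ hU
  have hν' : Tendsto μ (hyperfilter ℕ : Filter ℕ) (𝓝 ν) := hν
  have hchar : ∀ t, charFun (ν : Measure ℝ) t = f t := by
    intro t
    have h1 : Tendsto (fun n => charFun (μ n : Measure ℝ) t) (hyperfilter ℕ : Filter ℕ)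
        (𝓝 (charFun (ν : Measure ℝ) t)) := by
      rw [ProbabilityMeasure.tendsto_iff_forall_integral_rclike_tendsto ℂ] at hν'
      simp_rw [charFun_eq_integral_innerProbChar]
      exact hν' (BoundedContinuousFunction.innerProbChar t)
    exact tendsto_nhds_unique h1 ((h t).mono_left Nat.hyperfilter_le_atTop)
  exact ⟨ν, ProbabilityMeasure.tendsto_of_tendsto_charFun fun t => by rw [hchar]; exact h t, hchar⟩

/-- The characteristic function of a symmetric law is a cosine transform. -/
lemma charFun_eq_integral_cos {μ : Measure ℝ} [IsProbabilityMeasure μ]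
    (hμ : μ.map (fun x => -x) = μ) (t : ℝ) :
    charFun μ t = ((∫ x, Real.cos (t * x) ∂μ : ℝ) : ℂ) := by
  -- Symmetry makes the characteristic function even, and evaluation at $-t$ conjugates it, so it is
  -- real.
  have h1 : charFun μ (-t) = charFun μ t := by
    conv_rhs => rw [← hμ]
    have := charFun_map_mul (μ := μ) (-1) t
    simpa using this.symm
  rw [charFun_neg] at h1
  have h2 : ((charFun μ t).re : ℂ) = charFun μ t := Complex.conj_eq_iff_re.1 h1
  rw [← h2, charFun_apply_real]
  congr 1
  have hint : Integrable (fun x : ℝ => Complex.exp (t * x * Complex.I)) μ := by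
    refine Integrable.of_bound (Continuous.aestronglyMeasurable (by fun_prop)) 1
      (ae_of_all _ fun x => ?_)
    rw [← Complex.ofReal_mul, Complex.norm_exp_ofReal_mul_I]
  have h3 := integral_re hint
  simp only [RCLike.re_eq_complex_re] at h3
  rw [← h3]
  refine integral_congr_ae (ae_of_all _ fun x => ?_)
  dsimp only
  rw [← Complex.ofReal_mul, Complex.exp_ofReal_mul_I_re]

lemma abs_integral_cos_le_one {μ : Measure ℝ} [IsProbabilityMeasure μ] (t : ℝ) :
    |∫ x, Real.cos (t * x) ∂μ| ≤ 1 := by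
  have := norm_integral_le_of_norm_le_const (μ := μ) (f := fun x => Real.cos (t * x)) (C := 1)
    (ae_of_all _ fun x => Real.abs_cos_le_one _)
  simpa using this

lemma continuous_integral_cos {μ : Measure ℝ} [IsProbabilityMeasure μ] :
    Continuous fun t => ∫ x, Real.cos (t * x) ∂μ := by
  refine continuous_of_dominated (bound := fun _ => 1) (fun t => ?_) (fun t => ?_)
    (integrable_const 1) (ae_of_all _ fun x => by fun_prop)
  · exact Continuous.aestronglyMeasurable (by fun_prop)
  · exact ae_of_all _ fun x => Real.abs_cos_le_one _

/-- The integral over the half-line of `1 - φ (t x⁻ᵃ)`, for the cosine transform `φ` of a law. -/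
lemma integral_one_sub_integral_cos {a α : ℝ} (ha : 1 / 2 < a) (hα : α = 1 / a)
    {μ : Measure ℝ} [IsProbabilityMeasure μ] (hμ : Integrable (fun y => |y| ^ α) μ) (t : ℝ) :
    IntegrableOn (fun x : ℝ => 1 - ∫ y, Real.cos (t * x ^ (-a) * y) ∂μ) (Ioi 0) ∧
      ∫ x in Ioi (0 : ℝ), (1 - ∫ y, Real.cos (t * x ^ (-a) * y) ∂μ) =
        |t| ^ α * (∫ y, |y| ^ α ∂μ) / stableConst α := by
  have e : ∀ x y : ℝ, t * x ^ (-a) * y = (t * y) * x ^ (-a) := fun x y => by ring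
  simp_rw [e]
  have hm : AEStronglyMeasurable (fun p : ℝ × ℝ => 1 - Real.cos ((t * p.2) * p.1 ^ (-a)))
      ((volume.restrict (Ioi 0)).prod μ) := Measurable.aestronglyMeasurable (by fun_prop)
  have hnn : ∀ z : ℝ, ‖1 - Real.cos z‖ = 1 - Real.cos z := fun z => by
    rw [Real.norm_eq_abs, abs_of_nonneg (sub_nonneg.2 (Real.cos_le_one z))]
  have hval : ∀ y : ℝ, ∫ x in Ioi (0 : ℝ), (1 - Real.cos ((t * y) * x ^ (-a))) =
      |t| ^ α / stableConst α * |y| ^ α := fun y => by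
    rw [(integral_one_sub_cos_mul_rpow_neg ha hα (t * y)).2, abs_mul,
      Real.mul_rpow (abs_nonneg _) (abs_nonneg _)]
    ring
  -- The integrand is nonnegative with $x$-integral a multiple of $|y|^\alpha$, so the moment
  -- hypothesis is exactly what Fubini needs.
  have hprod : Integrable (fun p : ℝ × ℝ => 1 - Real.cos ((t * p.2) * p.1 ^ (-a)))
      ((volume.restrict (Ioi 0)).prod μ) := by
    rw [integrable_prod_iff' hm]
    refine ⟨ae_of_all _ fun y => (integral_one_sub_cos_mul_rpow_neg ha hα (t * y)).1, ?_⟩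
    simp only [hnn, hval]
    exact hμ.const_mul _
  have hsub : ∀ x : ℝ, 1 - ∫ y, Real.cos ((t * y) * x ^ (-a)) ∂μ =
      ∫ y, (1 - Real.cos ((t * y) * x ^ (-a))) ∂μ := fun x => by
    rw [integral_sub (integrable_const 1), integral_const]
    · simp
    · exact Integrable.of_bound (Measurable.aestronglyMeasurable (by fun_prop)) 1
        (ae_of_all _ fun x => Real.abs_cos_le_one _)
  simp_rw [hsub]
  refine ⟨hprod.integral_prod_left, ?_⟩
  rw [integral_integral_swap hprod]
  simp_rw [hval]
  rw [integral_const_mul]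
  ring

/-! ### The LePage series -/

lemma sum_interarrival {Ω : Type*} (G : ℕ → Ω → ℝ) (n : ℕ) (ω : Ω) :
    ∑ j ∈ Finset.range (n + 1), interarrival G j ω = G (n + 1) ω := by
  induction n with
  | zero => simp [interarrival]
  | succ n ih => rw [Finset.sum_range_succ, ih]; simp [interarrival]

section Series

variable {Ω : Type*} [MeasurableSpace Ω] {P : Measure Ω} [IsProbabilityMeasure P]

/-- The characteristic function of a sum of i.i.d. symmetric variables with independent random
coefficients. -/
lemma charFun_map_sum_mul_of_symm {η : ℕ → Ω → ℝ} {T : ℕ → Ω → ℝ}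
    (hind : iIndepFun η P) (hident : ∀ n, IdentDistrib (η n) (η 0) P P)
    (hηT : IndepFun (fun ω n => η n ω) (fun ω n => T n ω) P)
    (hsymm : IdentDistrib (η 0) (fun ω => -η 0 ω) P P) (hT : ∀ n, AEMeasurable (T n) P)
    {w : ℝ → ℝ} (hw : Measurable w) (n : ℕ) (t : ℝ) :
    charFun (P.map fun ω => ∑ k ∈ Finset.range n, η k ω * w (T k ω)) t =
      ((∫ ω, ∏ k ∈ Finset.range n,
        (∫ y, Real.cos (t * w (T k ω) * y) ∂(P.map (η 0))) ∂P : ℝ) : ℂ) := by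
  have hη : ∀ n, AEMeasurable (η n) P := fun n => (hident n).aemeasurable_fst
  have := Measure.isProbabilityMeasure_map (hη 0)
  have hsymm' : (P.map (η 0)).map (fun x => -x) = P.map (η 0) := by
    rw [AEMeasurable.map_map_of_aemeasurable measurable_neg.aemeasurable (hη 0)]
    exact hsymm.map_eq.symm
  have hS : AEMeasurable (fun ω => ∑ k ∈ Finset.range n, η k ω * w (T k ω)) P :=
    Finset.aemeasurable_fun_sum _ fun k _ => (hη k).mul (hw.comp_aemeasurable (hT k))
  rw [charFun_apply_real, integral_map hS (Continuous.aestronglyMeasurable (by fun_prop))]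
  set f : (ℕ → ℝ) × (ℕ → ℝ) → ℂ := fun p =>
    Complex.exp (t * ((∑ k ∈ Finset.range n, p.2 k * w (p.1 k) : ℝ) : ℂ) * Complex.I) with hf
  have hfm : StronglyMeasurable f := Measurable.stronglyMeasurable (by fun_prop)
  have hfb : ∀ p, ‖f p‖ ≤ 1 := fun p => by
    simp only [hf]
    rw [← Complex.ofReal_mul, Complex.norm_exp_ofReal_mul_I]
  have hηs : AEMeasurable (fun ω n => η n ω) P := aemeasurable_pi_lambda _ hη
  have key := hηT.symm.integral_comp_prodMk (aemeasurable_pi_lambda _ hT) hηs hfm hfb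
  refine key.trans ?_
  rw [← integral_complex_ofReal]
  refine integral_congr_ae (ae_of_all _ fun ω => ?_)
  dsimp only
  have hfω : Measurable fun y => f (fun n => T n ω, y) := by fun_prop
  rw [integral_map hηs hfω.aestronglyMeasurable]
  -- With the coefficients frozen, the summands are independent and the expectation factors.
  have hind' : iIndepFun (fun (k : Finset.range n) ω' =>
      Complex.exp (t * w (T k ω) * η k ω' * Complex.I)) P :=
    (hind.precomp (g := ((↑) : Finset.range n → ℕ)) Subtype.val_injective).comp
      (fun k x => Complex.exp (t * w (T k ω) * x * Complex.I)) fun k => by fun_prop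
  have hprod := hind'.integral_fun_prod_eq_prod_integral fun k => by
    have := hη k
    exact AEMeasurable.aestronglyMeasurable (by fun_prop)
  rw [Finset.prod_coe_sort (Finset.range n)
    fun k => ∫ ω', Complex.exp (t * w (T k ω) * η k ω' * Complex.I) ∂P] at hprod
  have hlhs : ∀ ω', f (fun n => T n ω, fun n => η n ω') = ∏ k : Finset.range n,
      Complex.exp (t * w (T k ω) * η k ω' * Complex.I) := by
    intro ω'
    rw [Finset.prod_coe_sort (Finset.range n)
      fun k => Complex.exp (t * w (T k ω) * η k ω' * Complex.I), ← Complex.exp_sum, hf]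
    dsimp only
    congr 1
    push_cast
    rw [Finset.mul_sum, Finset.sum_mul]
    exact Finset.sum_congr rfl fun k _ => by ring
  simp_rw [hlhs]
  rw [hprod, Complex.ofReal_prod]
  refine Finset.prod_congr rfl fun k _ => ?_
  rw [← charFun_eq_integral_cos hsymm', ← (hident k).map_eq, charFun_apply_real,
    integral_map (hη k) (Continuous.aestronglyMeasurable (by fun_prop))]
  push_cast
  rfl

/-- The partial sums of the LePage series have characteristic functions converging to that of a
symmetric stable law. -/
lemma tendsto_charFun_lePage {a α : ℝ} (ha : 1 / 2 < a) (hα : α = 1 / a)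
    {G : ℕ → Ω → ℝ} (hG : IsPoissonArrivalTimes 1 G P) {η : ℕ → Ω → ℝ}
    (hind : iIndepFun η P) (hident : ∀ n, IdentDistrib (η n) (η 0) P P)
    (hηG : IndepFun (fun ω n => η n ω) (fun ω n => G (n + 1) ω) P)
    (hsymm : IdentDistrib (η 0) (fun ω => -η 0 ω) P P)
    (hmom : Integrable (fun ω => |η 0 ω| ^ α) P) (t : ℝ) :
    Tendsto (fun n => charFun
        (P.map fun ω => ∑ k ∈ Finset.range n, η k ω * (max (G (k + 1) ω) 0) ^ (-a)) t) atTop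
      (𝓝 (Complex.exp (-(|t| ^ α * (∫ ω, |η 0 ω| ^ α ∂P) / stableConst α : ℝ)))) := by
  have ha0 : 0 < a := by linarith
  have hη0 : AEMeasurable (η 0) P := (hident 0).aemeasurable_fst
  have := Measure.isProbabilityMeasure_map hη0
  have hGm : ∀ n, AEMeasurable (G (n + 1)) P := by
    intro n
    have : AEMeasurable (fun ω => ∑ j ∈ Finset.range (n + 1), interarrival G j ω) P :=
      Finset.aemeasurable_fun_sum _ fun j _ => (hG.law j).aemeasurable
    simpa only [sum_interarrival] using this
  have hpow : AEStronglyMeasurable (fun y : ℝ => |y| ^ α) (P.map (η 0)) :=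
    Measurable.aestronglyMeasurable (by fun_prop)
  have hmom' : Integrable (fun y : ℝ => |y| ^ α) (P.map (η 0)) :=
    (integrable_map_measure hpow hη0).2 hmom
  obtain ⟨hI, hV⟩ := integral_one_sub_integral_cos ha hα hmom' t
  -- Truncation at 0 makes $1-h$ vanish on $(-\infty,0]$, because `0 ^ (-a) = 0` in `ℝ`; thus it is
  -- integrable on the whole line.
  set h : ℝ → ℝ := fun x => ∫ y, Real.cos (t * (max x 0) ^ (-a) * y) ∂(P.map (η 0)) with hh
  have hpos : ∀ x ∈ Ioi (0 : ℝ), 1 - ∫ y, Real.cos (t * x ^ (-a) * y) ∂(P.map (η 0)) = 1 - h x := by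
    intro x hx
    rw [hh]
    dsimp only
    rw [max_eq_left (le_of_lt hx)]
  have hi : Integrable (fun x => 1 - h x) := by
    rw [integrableOn_congr_fun hpos measurableSet_Ioi] at hI
    refine hI.integrable_of_forall_notMem_eq_zero fun x hx => ?_
    have hx' : x ≤ 0 := not_lt.1 hx
    simp [hh, max_eq_right hx', Real.zero_rpow (neg_ne_zero.2 ha0.ne')]
  rw [setIntegral_congr_fun measurableSet_Ioi hpos, integral_map hη0 hpow] at hV
  have hC := continuous_integral_cos (μ := P.map (η 0))
  have hm : Measurable h :=
    hC.measurable.comp (g := fun t => ∫ y, Real.cos (t * y) ∂(P.map (η 0)))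
      (f := fun x => t * (max x 0) ^ (-a)) (by fun_prop)
  have hc : ContinuousOn h (Ioi 0) := by
    refine hC.comp_continuousOn (f := fun x => t * (max x 0) ^ (-a)) ?_
    refine continuousOn_const.mul (ContinuousOn.rpow_const (by fun_prop) fun x hx => Or.inl ?_)
    rw [max_eq_left (le_of_lt hx)]
    exact ne_of_gt hx
  have h1 : ∀ x, |h x| ≤ 1 := fun x => abs_integral_cos_le_one _
  have key := tendsto_integral_prod_arrivals hG.indep hG.law hm hi h1 hc
  rw [hV] at key
  simp only [sum_interarrival] at key
  have := (Complex.continuous_ofReal.tendsto _).comp key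
  push_cast at this ⊢
  refine this.congr fun n => ?_
  rw [charFun_map_sum_mul_of_symm hind hident hηG hsymm hGm (w := fun x => (max x 0) ^ (-a))
    (by fun_prop)]
  rfl

end Series

/-! ### Identification of the limit and the theorem -/

/-- Zero skewness merges the cases $\alpha=1$ and $\alpha\ne1$, and $a\alpha=1$ undoes the power in
$\sigma$. -/
lemma stableExponent_zero_skewness {a α : ℝ} (ha : 1 / 2 < a) (hα : α = 1 / a) {m : ℝ}
    (hm : 0 ≤ m) (t : ℝ) :
    stableExponent α ((m / stableConst α) ^ a) 0 1 t =
      t * Complex.I + (-(|t| ^ α * m / stableConst α : ℝ) : ℂ) := by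
  have ha0 : 0 < a := by linarith
  have h0 : 0 < α := by rw [hα]; positivity
  have h2 : α < 2 := by rw [hα, div_lt_iff₀ ha0]; linarith
  have hc := stableConst_pos h0 h2
  have hσ : ((m / stableConst α) ^ a) ^ α = m / stableConst α := by
    rw [← Real.rpow_mul (by positivity), hα, mul_one_div_cancel ha0.ne', Real.rpow_one]
  unfold stableExponent
  split_ifs with h1
  · rw [h1, Real.rpow_one] at hσ
    rw [h1, hσ, Real.rpow_one]
    push_cast
    ring
  · rw [hσ]
    push_cast
    ring

theorem theorem1 {Ω : Type*} [MeasurableSpace Ω] (P : Measure Ω) [IsProbabilityMeasure P]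
    (a α : ℝ) (ha : 1 / 2 < a) (hα : α = 1 / a)
    -- arrival times `G₁, G₂, …`, with the convention `G₀ = 1` for the recursion
    (G : ℕ → Ω → ℝ) (hG : IsPoissonArrivalTimes 1 G P) (hG0 : ∀ ω, G 0 ω = 1)
    -- the innovations `ε₁, ε₂, …`; `ε 0` is not used
    (ε : ℕ → Ω → ℝ)
    (hε_indep : iIndepFun (fun n => ε (n + 1)) P)
    (hε_ident : ∀ n, IdentDistrib (ε (n + 1)) (ε 1) P P)
    (hε_G : IndepFun (fun ω (n : ℕ) => ε (n + 1) ω) (fun ω (n : ℕ) => G (n + 1) ω) P)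
    (hε_symm : IdentDistrib (ε 1) (fun ω => -ε 1 ω) P P)
    (hε_moment : Integrable (fun ω => |ε 1 ω| ^ α) P)
    (X : ℕ → Ω → ℝ) (hX0 : ∀ ω, X 0 ω = 1)
    (hX : ∀ n ω, X (n + 1) ω = (G (n + 1) ω / G n ω) ^ a * X n ω + ε (n + 1) ω) :
    ∃ ν : ProbabilityMeasure ℝ,
      TendstoInDistribution (fun (n : ℕ) ω => X n ω / (n : ℝ) ^ a) atTop (id : ℝ → ℝ)
        (fun _ => P) (ν : Measure ℝ) ∧
      IsStableLaw α (((∫ ω, |ε 1 ω| ^ α ∂P) / stableConst α) ^ a) 0 1 (ν : Measure ℝ) := by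
  have ha0 : 0 < a := by linarith
  have h0 : 0 < α := by rw [hα]; positivity
  have h2 : α < 2 := by rw [hα, div_lt_iff₀ ha0]; linarith
  have hc := stableConst_pos h0 h2
  have hE0 : 0 ≤ ∫ ω, |ε 1 ω| ^ α ∂P := integral_nonneg fun ω => by positivity
  have hεm : ∀ n, AEMeasurable (ε (n + 1)) P := fun n => (hε_ident n).aemeasurable_fst
  have hGm : ∀ n, AEMeasurable (G n) P := by
    rintro (_ | n)
    · exact (measurable_const (a := (1 : ℝ))).aemeasurable.congr (ae_of_all _ fun ω => (hG0 ω).symm)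
    · have : AEMeasurable (fun ω => ∑ j ∈ Finset.range (n + 1), interarrival G j ω) P :=
        Finset.aemeasurable_fun_sum _ fun j _ => (hG.law j).aemeasurable
      simpa only [sum_interarrival] using this
  have hGpos : ∀ᵐ ω ∂P, ∀ n, 0 < G n ω := by
    filter_upwards [ae_forall_pos_of_hasLaw_exp hG.law] with ω hω
    rintro (_ | n)
    · rw [hG0]; exact one_pos
    · rw [← sum_interarrival G n ω]
      exact Finset.sum_pos (fun j _ => hω j) (by simp)
  have hGlim : ∀ᵐ ω ∂P, Tendsto (fun n : ℕ => (G n ω / n) ^ a) atTop (𝓝 1) := by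
    filter_upwards [tendsto_sum_div_of_hasLaw_exp hG.indep hG.law] with ω hω
    rw [← Real.one_rpow a]
    refine Tendsto.rpow_const (hω.congr' ?_) (Or.inl one_ne_zero)
    filter_upwards [eventually_ge_atTop 1] with n hn
    obtain ⟨k, rfl⟩ := Nat.exists_eq_add_of_le' hn
    rw [sum_interarrival]
  -- The truncation is harmless, the arrivals being almost surely positive.
  set L : ℕ → Ω → ℝ := fun n ω =>
    ∑ k ∈ Finset.range n, ε (k + 1) ω * (max (G (k + 1) ω) 0) ^ (-a) with hL
  have hLm : ∀ n, AEMeasurable (L n) P := fun n => Finset.aemeasurable_fun_sum _ fun k _ =>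
    (hεm k).mul (((hGm (k + 1)).max aemeasurable_const).pow_const _)
  -- the recursion is solved by a series
  have hXL : ∀ᵐ ω ∂P, ∀ n, X n ω = G n ω ^ a * (1 + L n ω) := by
    filter_upwards [hGpos] with ω hω n
    induction n with
    | zero => simp [hX0, hG0, hL]
    | succ n ih =>
      have h1 : G n ω ^ a ≠ 0 := (Real.rpow_pos_of_pos (hω n) a).ne'
      have h3 : G (n + 1) ω ^ a ≠ 0 := (Real.rpow_pos_of_pos (hω (n + 1)) a).ne'
      rw [hX, ih, hL]
      dsimp only
      rw [Finset.sum_range_succ, max_eq_left (hω (n + 1)).le, Real.rpow_neg (hω (n + 1)).le,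
        Real.div_rpow (hω (n + 1)).le (hω n).le]
      field_simp
      ring
  have hSm : ∀ n, AEMeasurable (fun ω => 1 + L n ω) P := fun n => (hLm n).const_add 1
  have hprob : ∀ n, IsProbabilityMeasure (P.map fun ω => 1 + L n ω) :=
    fun n => Measure.isProbabilityMeasure_map (hSm n)
  set φ : ℝ → ℂ := fun t => Complex.exp (t * Complex.I +
    (-(|t| ^ α * (∫ ω, |ε 1 ω| ^ α ∂P) / stableConst α : ℝ) : ℂ)) with hφ
  have hφc : ContinuousAt φ 0 := by
    have h4 : Continuous fun t : ℝ => |t| ^ α := continuous_abs.rpow_const fun _ => Or.inr h0.le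
    have : Continuous φ := by fun_prop
    exact this.continuousAt
  have hlim : ∀ t, Tendsto (fun n => charFun
      ((⟨P.map fun ω => 1 + L n ω, hprob n⟩ : ProbabilityMeasure ℝ) : Measure ℝ) t) atTop
      (𝓝 (φ t)) := by
    intro t
    have h4 := (tendsto_charFun_lePage ha hα hG hε_indep hε_ident hε_G hε_symm hε_moment t).const_mul
      (Complex.exp (t * Complex.I))
    rw [← Complex.exp_add] at h4
    refine h4.congr fun n => ?_
    have h5 := charFun_map_const_add (μ := P.map (L n)) 1 t
    rw [AEMeasurable.map_map_of_aemeasurable (by fun_prop) (hLm n)] at h5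
    refine Eq.trans ?_ h5.symm
    rw [mul_comm]
    simp [hL]
  obtain ⟨ν, hν, hνφ⟩ := exists_tendsto_of_tendsto_charFun hφc hlim
  refine ⟨ν, ?_, ⟨h0, h2.le, by positivity, by simp, inferInstance, fun t => ?_⟩⟩
  · have hS : TendstoInDistribution (fun n ω => 1 + L n ω) atTop (id : ℝ → ℝ) (fun _ => P)
        (ν : Measure ℝ) := by
      refine ⟨hSm, aemeasurable_id, ?_⟩
      simp only [Measure.map_id]
      exact hν
    have hRm : ∀ n : ℕ, AEMeasurable (fun ω => (G n ω / n) ^ a) P :=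
      fun n => ((hGm n).div_const _).pow_const _
    have hR : TendstoInMeasure P (fun (n : ℕ) ω => (G n ω / n) ^ a) atTop fun _ => 1 :=
      tendstoInMeasure_of_tendsto_ae (fun n => (hRm n).aestronglyMeasurable) hGlim
    -- Slutsky's lemma.
    have hmul := hS.continuous_comp_prodMk_of_tendstoInMeasure_const
      (g := fun p : ℝ × ℝ => p.2 * p.1) (by fun_prop) hR hRm
    -- The identity holds even at $n=0$, where division by zero makes both sides 0.
    refine hmul.congr (fun n => ?_) (ae_of_all _ fun x => by simp)
    filter_upwards [hXL, hGpos] with ω hω hp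
    rw [hω n, Real.div_rpow (hp n).le (Nat.cast_nonneg n)]
    ring
  · rw [hνφ, hφ, stableExponent_zero_skewness ha hα hE0]
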